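/- Theorem 1.4 (Expansion formulas for the Alexander–Conway polynomial). Let $\nabla$ denote the Alexander–Conway polynomial of oriented link diagrams, with values in $\mathbb{C}[s,s^{-1}]$: it is the isotopy invariant with $\nabla(\bigcirc)=1$ and $$\nabla(L_-)-(s^{-1}-s)\,\nabla(L_0)-\nabla(L_+)=0$$ whenever $L_+,L_0,L_-$ are the same except near one crossing, which is positive in $L_+$, negative in $L_-$ and smoothed (respecting the orientation) in $L_0$. For $a\in\mathbb{Z}$ put $C^{a}(s)=(-1)^{a}s^{a-1}+s^{1-a}$. Let $x_1,\dots,x_{n-1}$ be the Artin generators of the braid group $\mathcal{B}_n$, where $x_i$ is the crossing of the strands $i$ and $i+1$ that is negative when both strands are oriented downwards. For $\beta\in\mathcal{B}_n$ let $\nabla_n(\beta)$ be the Alexander–Conway polynomial of the closure of $\beta$, all strands of $\beta$ being oriented downwards. (1) For all $n,k\ge 0$, all $i_1,\dots,i_k\in\{1,\dots,n-1\}$ and all $a_1,\dots,a_k\in\mathbb{Z}$, the following equality holds in $\mathbb{C}(s)$: $$\nabla_{n}(x_{i_{1}}^{a_{1}}\cdots x_{i_{k}}^{a_{k}})(s)=\Big(\frac{s}{s^2+1}\Big)^{k}\sum_{0\le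 j_{1},\dots,j_{k}\le 1}C^{a_{1}+j_{1}}(s)\cdots C^{a_{k}+j_{k}}(s)\,\nabla_{n}(x_{i_{1}}^{j_{1}}\cdots x_{i_{k}}^{j_{k}})(s).$$ (2) (Relative version.) Let $p\ge 0$ and let $\mathcal{L}$ be an oriented link diagram with $p$ disjoint boxes $R_1,\dots,R_p$, each of which is met by two strands that run through it in the same direction. For $k_1,\dots,k_p\in\mathbb{Z}$ let $\nabla_{\mathcal{L}}(k_1,\dots,k_p)$ be the Alexander–Conway polynomial of the link diagram $\mathcal{L}(R_{k_1},\dots,R_{k_p})$ in which, for each $m$, the $m$-th box contains the 2-braid $x_1^{k_m}$ and the rest of the diagram is fixed. Then, for all $k_1,\dots,k_p\in\mathbb{Z}$, the following equality holds in $\mathbb{C}(s)$: $$\nabla_{\mathcal{L}}(k_{1},\dots,k_{p})(s)=\Big(\frac{s}{s^2+1}\Big)^{p}\sum_{0\le j_{1},\dots,j_{p}\le 1}C^{k_{1}+j_{1}}(s)\cdots C^{k_{p}+j_{p}}(s)\,\nabla_{\mathcal{L}}(j_{1},\dots,j_{p})(s).$$ -/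

import Mathlib

/-!
# Oriented link diagrams, the Alexander-Conway polynomial, closed braids and twist families

Link diagrams are drawn in general position with respect to the height function and are cut into
horizontal slices, each with one maximum, one minimum or one crossing. They are read from the top
to the bottom; the strands that meet a horizontal level are numbered from the left, from `0`.
A strand carries `true` if it is oriented downwards there and `false` if it is oriented upwards.
-/

namespace Conway

/-- What happens in a slice, apart from vertical strands. -/
inductive Piece where
  /-- A local maximum. Two new strands start; the left one has orientation `o`, the right one the
  opposite orientation. -/
  | birth (o : Bool)
  /-- A local minimum. Two adjacent strands of opposite orientations are joined and end. -/
  | death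
  /-- A crossing of two adjacent strands. If `b = true`, then the strand that runs between upper
  left and lower right passes over the other one; if `b = false`, it passes under. -/
  | cross (b : Bool)

/-- A slice: a piece and the number of strands to the left of it. -/
abbrev Slice := ℕ × Piece

/-- The effect of a piece at the far left on the list of orientations (`none` if impossible). -/
def Piece.act : Piece → List Bool → Option (List Bool)
  | .birth o, l => some (o :: (!o) :: l)
  | .death, a :: b :: l => if b = !a then some l else none
  | .cross _, a :: b :: l => some (b :: a :: l)
  | _, _ => none

/-- The effect of a piece with `i` strands to the left of it on the list of orientations. -/
def Piece.actAt (e : Piece) : ℕ → List Bool → Option (List Bool)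
  | 0, l => e.act l
  | i + 1, a :: l => (e.actAt i l).map (a :: ·)
  | _ + 1, [] => none

/-- The orientations below a sequence of slices, in terms of those above it. -/
def run : List Slice → List Bool → Option (List Bool)
  | [], l => some l
  | (i, e) :: w, l => (e.actAt i l).bind (run w)

/-- An oriented link diagram: a sequence of slices that fit together, with consistent
orientations, and with no strand at the top or at the bottom. -/
structure LinkDiagram where
  word : List Slice
  closed : run word [] = some []

/-- The number of strands that enter a piece from above. -/
def Piece.tops : Piece → ℕ
  | .birth _ => 0
  | _ => 2

/-- The number of strands that leave a piece below. -/
def Piece.bottoms : Piece → ℕ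
  | .death => 0
  | _ => 2

/-- The slice with one more vertical strand at the left. -/
def Slice.right (x : Slice) : Slice := (x.1 + 1, x.2)

open Piece in
/-- The local moves: exchange of the heights of two distant pieces, the planar isotopies that
cancel a maximum against a minimum or pull a strand across a maximum or a minimum, and the three
Reidemeister moves. By the last constructor any number of vertical strands may stand to the left.
(Strands to the right are not recorded in a slice.) -/
inductive Move : List Slice → List Slice → Prop
  | far (e e' : Piece) (d : ℕ) :
      Move [(0, e), (e.bottoms + d, e')] [(e.tops + d, e'), (0, e)]
  | zigzag_left (o : Bool) : Move [(1, birth o), (0, death)] []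
  | zigzag_right (o : Bool) : Move [(0, birth o), (1, death)] []
  | slide_birth (o b : Bool) :
      Move [(1, birth o), (0, cross b)] [(0, birth o), (1, cross (!b))]
  | slide_death (b : Bool) : Move [(0, cross b), (1, death)] [(1, cross (!b)), (0, death)]
  | reidemeister_one_birth (o b : Bool) : Move [(0, birth o), (0, cross b)] [(0, birth (!o))]
  | reidemeister_one_death (b : Bool) : Move [(0, cross b), (0, death)] [(0, death)]
  | reidemeister_two (b : Bool) : Move [(0, cross b), (0, cross (!b))] []
  | reidemeister_three (b c d : Bool) (h : c = b ∨ c = d) :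
      Move [(0, cross b), (1, cross c), (0, cross d)] [(1, cross d), (0, cross c), (1, cross b)]
  | right {m m' : List Slice} : Move m m' → Move (m.map Slice.right) (m'.map Slice.right)

/-- Two diagrams that differ by one local move. -/
def ElementaryIsotopy (D D' : LinkDiagram) : Prop :=
  ∃ u m m' v : List Slice, Move m m' ∧ D.word = u ++ m ++ v ∧ D'.word = u ++ m' ++ v

/-- Isotopy of oriented link diagrams. -/
def Isotopic : LinkDiagram → LinkDiagram → Prop := Relation.EqvGen ElementaryIsotopy

/-- The circle without crossings. -/
def unknot : LinkDiagram := ⟨[(0, .birth true), (0, .death)], rfl⟩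

/-- `Dplus`, `Dzero`, `Dminus` are the same except near one crossing of two strands that run in the
same direction: it is positive in `Dplus`, negative in `Dminus` and smoothed in `Dzero`. (Every
crossing is brought to this position by a rotation, which is an isotopy.) For two strands with the
same direction the crossing is negative exactly if the strand between upper left and lower right
passes over. -/
def SkeinTriple (Dplus Dzero Dminus : LinkDiagram) : Prop :=
  ∃ (u v : List Slice) (l l' : List Bool) (o : Bool),
    run u [] = some (l ++ o :: o :: l') ∧
    Dplus.word = u ++ (l.length, Piece.cross false) :: v ∧
    Dzero.word = u ++ v ∧
    Dminus.word = u ++ (l.length, Piece.cross true) :: v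

open LaurentPolynomial in
/-- The defining properties of the Alexander-Conway polynomial, with values in the Laurent
polynomials in `s = T 1`, where `s⁻¹ = T (-1)`: isotopy invariance, normalization, and
`∇(L₋) - (s⁻¹ - s) ∇(L₀) - ∇(L₊) = 0`. -/
structure IsAlexanderConway (f : LinkDiagram → LaurentPolynomial ℂ) : Prop where
  isotopy : ∀ D D', Isotopic D D' → f D = f D'
  normalization : f unknot = 1
  skein : ∀ Dplus Dzero Dminus, SkeinTriple Dplus Dzero Dminus →
    f Dminus - (T (-1) - T 1) * f Dzero - f Dplus = 0

/-!
### Existence of the Alexander-Conway polynomial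

The following state sum (of free fermion type, one edge being cut open) is only used to prove that
a function with the properties `IsAlexanderConway` exists. Strands are coloured by `Bool`; a label
is a pair (orientation, colour).
-/

section StateSum
variable {R : Type*} [CommRing R]

abbrev Lab := Bool × Bool
def Lab.flip (a : Lab) : Lab := (a.1, !a.2)

def sgn (R : Type*) [CommRing R] (c : Bool) : R := if c then -1 else 1
def wBirth (t : R) (o c : Bool) : R := if o then t * sgn R c else 1
def wDeath (s : R) (o c : Bool) : R := if o then 1 else s * sgn R c
def stay (s t : R) : Bool → Bool → Bool → R
  | true, false, true => t - s
  | false, true, false => s - t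
  | _, _, _ => 0
def diagW (s t : R) : Bool → Bool → R
  | true, false => t
  | true, true => -s
  | false, false => s
  | false, true => -t
def wPass (s t : R) (b : Bool) (a a' : Lab) : R :=
  if a.2 = a'.2 then (if a.1 = a'.1 then diagW s t b a.2 else diagW s t (!b) a.2) else 1
def wFlip (s t : R) (b : Bool) (a a' : Lab) : R :=
  match a.1, a'.1 with
  | true, true => stay s t b a.2 a'.2
  | false, false => stay s t b a'.2 a.2
  | true, false => if a.2 = a'.2 then stay s t (!b) (!a.2) a.2 else 0
  | false, true => if a.2 = a'.2 then -stay s t (!b) a.2 (!a.2) else 0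

def op (s t : R) : Piece → (List Lab → R) → List Lab → R
  | .birth o, f, x => wBirth t o false * f ((o, false) :: (!o, false) :: x)
      + wBirth t o true * f ((o, true) :: (!o, true) :: x)
  | .death, f, a :: b :: x => if b = (!a.1, a.2) then wDeath s a.1 a.2 * f x else 0
  | .cross c, f, a :: b :: x => wPass s t c a b * f (b :: a :: x)
      + wFlip s t c a b * f (b.flip :: a.flip :: x)
  | _, _, _ => 0

def opAt (s t : R) (e : Piece) : ℕ → (List Lab → R) → List Lab → R
  | 0, f, x => op s t e f x
  | i + 1, f, a :: x => opAt s t e i (fun y => f (a :: y)) x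
  | _ + 1, _, [] => 0

def ev (s t : R) : List Slice → (List Lab → R) → List Lab → R
  | [], f => f
  | (i, e) :: w, f => opAt s t e i (ev s t w f)

def EqOn (l : List Bool) (f g : List Lab → R) : Prop := ∀ x : List Lab, x.map Prod.fst = l → f x = g x

variable (s t : R)

theorem op_lin (e : Piece) (c d : R) (f g : List Lab → R) (x : List Lab) :
    op s t e (fun y => c * f y + d * g y) x = c * op s t e f x + d * op s t e g x := by
  cases e with
  | birth o => simp only [op]; ring
  | death =>
    match x with
    | [] => simp [op]
    | [a] => simp [op]
    | a :: b :: x => simp only [op]; split_ifs <;> ring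
  | cross c =>
    match x with
    | [] => simp [op]
    | [a] => simp [op]
    | a :: b :: x => simp only [op]; ring

theorem opAt_lin (e : Piece) (c d : R) (i : ℕ) (f g : List Lab → R) (x : List Lab) :
    opAt s t e i (fun y => c * f y + d * g y) x = c * opAt s t e i f x + d * opAt s t e i g x := by
  induction i generalizing f g x with
  | zero => exact op_lin s t e c d f g x
  | succ i ih =>
    cases x with
    | nil => simp [opAt]
    | cons a x => exact ih _ _ _

theorem ev_lin (w : List Slice) (c d : R) (f g : List Lab → R) (x : List Lab) :
    ev s t w (fun y => c * f y + d * g y) x = c * ev s t w f x + d * ev s t w g x := by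
  induction w generalizing x with
  | nil => rfl
  | cons p w ih =>
    obtain ⟨i, e⟩ := p
    simp only [ev]
    rw [show ev s t w (fun y => c * f y + d * g y) = fun x => c * ev s t w f x + d * ev s t w g x
      from funext ih, opAt_lin]

theorem ev_append (u v : List Slice) (f : List Lab → R) :
    ev s t (u ++ v) f = ev s t u (ev s t v f) := by
  induction u with
  | nil => rfl
  | cons p u ih => obtain ⟨i, e⟩ := p; simp only [List.cons_append, ev, ih]

theorem run_append (u v : List Slice) (l : List Bool) :
    run (u ++ v) l = (run u l).bind (run v) := by
  induction u generalizing l with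
  | nil => rfl
  | cons p u ih =>
    obtain ⟨i, e⟩ := p
    simp only [List.cons_append, run, Option.bind_assoc]
    congr 1; funext l; exact ih l

theorem op_congr (e : Piece) (l l' : List Bool) (f g : List Lab → R) (h : e.act l = some l')
    (hfg : EqOn l' f g) : EqOn l (op s t e f) (op s t e g) := by
  intro x hx
  subst hx
  cases e with
  | birth o =>
    simp only [Piece.act, Option.some.injEq] at h
    subst h
    simp only [op]
    rw [hfg _ (by simp), hfg _ (by simp)]
  | death =>
    match x with
    | [] => simp [op]
    | [a] => simp [op]
    | a :: b :: x =>
      simp only [op]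
      split_ifs with hb
      · subst hb
        simp only [Piece.act, List.map_cons, if_true, Option.some.injEq] at h
        rw [hfg x h]
      · rfl
  | cross c =>
    match x with
    | [] => simp [op]
    | [a] => simp [op]
    | a :: b :: x =>
      simp only [Piece.act, List.map_cons, Option.some.injEq] at h
      subst h
      simp only [op]
      rw [hfg _ (by simp), hfg _ (by simp [Lab.flip])]

theorem opAt_congr (e : Piece) (i : ℕ) (l l' : List Bool) (f g : List Lab → R)
    (h : e.actAt i l = some l') (hfg : EqOn l' f g) :
    EqOn l (opAt s t e i f) (opAt s t e i g) := by
  induction i generalizing l l' f g with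
  | zero => exact op_congr s t e l l' f g h hfg
  | succ i ih =>
    cases l with
    | nil => simp [Piece.actAt] at h
    | cons o l =>
      simp only [Piece.actAt, Option.map_eq_some_iff] at h
      obtain ⟨l₁, h₁, rfl⟩ := h
      intro x hx
      cases x with
      | nil => simp at hx
      | cons a x =>
        simp only [List.map_cons, List.cons.injEq] at hx
        exact ih l l₁ _ _ h₁ (fun y hy => hfg _ (by simp [hy, hx.1])) x hx.2

theorem ev_congr (w : List Slice) (l l' : List Bool) (f g : List Lab → R)
    (h : run w l = some l') (hfg : EqOn l' f g) : EqOn l (ev s t w f) (ev s t w g) := by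
  induction w generalizing l with
  | nil =>
    simp only [run, Option.some.injEq] at h; subst h; exact hfg
  | cons p w ih =>
    obtain ⟨i, e⟩ := p
    simp only [run, Option.bind_eq_some_iff] at h
    obtain ⟨l₁, h₁, h₂⟩ := h
    exact opAt_congr s t e i l l₁ _ _ h₁ (ih l₁ h₂)

theorem ev_right (m : List Slice) (f : List Lab → R) (a : Lab) (x : List Lab) :
    ev s t (m.map Slice.right) f (a :: x) = ev s t m (fun y => f (a :: y)) x := by
  induction m generalizing x with
  | nil => rfl
  | cons p m ih =>
    obtain ⟨i, e⟩ := p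
    simp only [List.map_cons, Slice.right, ev, opAt]
    congr 1; funext y; exact ih y

theorem run_right (m : List Slice) (a : Bool) (l : List Bool) :
    run (m.map Slice.right) (a :: l) = (run m l).map (a :: ·) := by
  induction m generalizing l with
  | nil => rfl
  | cons p m ih =>
    obtain ⟨i, e⟩ := p
    simp only [List.map_cons, Slice.right, run, Piece.actAt]
    cases e.actAt i l with
    | none => rfl
    | some l₁ => exact ih l₁

theorem far_eq (e e' : Piece) (d : ℕ) (f : List Lab → R) (x : List Lab) :
    ev s t [(0, e), (e.bottoms + d, e')] f x = ev s t [(e.tops + d, e'), (0, e)] f x := by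
  cases e with
  | birth o =>
    simp only [ev, opAt, op, Piece.bottoms, Piece.tops, Nat.zero_add, Nat.add_comm 2 d]
    exact (opAt_lin s t e' _ _ d _ _ x).symm
  | death =>
    simp only [ev, opAt, Piece.bottoms, Piece.tops, Nat.zero_add, Nat.add_comm 2 d]
    match x with
    | [] => simp [op, opAt]
    | [a] => simp [op, opAt]
    | a :: b :: x =>
      simp only [opAt, op]
      split_ifs with h
      · have := opAt_lin s t e' (wDeath s a.1 a.2) 0 d f f x
        simpa using this.symm
      · have := opAt_lin s t e' 0 0 d f f x
        simpa using this.symm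
  | cross c =>
    simp only [ev, opAt, Piece.bottoms, Piece.tops, Nat.add_comm 2 d]
    match x with
    | [] => simp [op, opAt]
    | [a] => simp [op, opAt]
    | a :: b :: x =>
      simp only [opAt, op]
      exact (opAt_lin s t e' _ _ d _ _ x).symm

theorem run_right_nil {m : List Slice} {l : List Bool}
    (h : run (m.map Slice.right) [] = some l) : m = [] := by
  cases m with
  | nil => rfl
  | cons p m => simp [run, Slice.right, Piece.actAt] at h

def crossL (b : Bool) (f : List Lab → R) : List Lab → R
  | a :: a' :: a'' :: x => wPass s t b a a' * f (a' :: a :: a'' :: x)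
      + wFlip s t b a a' * f (a'.flip :: a.flip :: a'' :: x)
  | x => f x

def crossR (b : Bool) (f : List Lab → R) : List Lab → R
  | a :: a' :: a'' :: x => wPass s t b a' a'' * f (a :: a'' :: a' :: x)
      + wFlip s t b a' a'' * f (a :: a''.flip :: a'.flip :: x)
  | x => f x

theorem cross_cancel (hst : s * t = 1) (b : Bool) (a a' : Lab) (f : Lab → Lab → R) :
    wPass s t b a a' * (wPass s t (!b) a' a * f a a' + wFlip s t (!b) a' a * f a.flip a'.flip)
      + wFlip s t b a a' * (wPass s t (!b) a'.flip a.flip * f a.flip a'.flip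
        + wFlip s t (!b) a'.flip a.flip * f a.flip.flip a'.flip.flip) = f a a' := by
  obtain ⟨a, c⟩ := a
  obtain ⟨a', c'⟩ := a'
  rcases a <;> rcases a' <;> rcases b <;> rcases c <;> rcases c' <;>
    simp [wPass, wFlip, diagW, stay, Lab.flip] <;> grind

def permL (hst : s * t = 1) : Equiv.Perm (List Lab → R) where
  toFun := crossL s t true
  invFun := crossL s t false
  left_inv f := by
    funext x
    rcases x with _ | ⟨a, _ | ⟨a', _ | ⟨a'', x⟩⟩⟩ <;> simp only [crossL]
    exact cross_cancel s t hst false a a' (fun a a' => f (a :: a' :: a'' :: x))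
  right_inv f := by
    funext x
    rcases x with _ | ⟨a, _ | ⟨a', _ | ⟨a'', x⟩⟩⟩ <;> simp only [crossL]
    exact cross_cancel s t hst true a a' (fun a a' => f (a :: a' :: a'' :: x))

def permR (hst : s * t = 1) : Equiv.Perm (List Lab → R) where
  toFun := crossR s t true
  invFun := crossR s t false
  left_inv f := by
    funext x
    rcases x with _ | ⟨a, _ | ⟨a', _ | ⟨a'', x⟩⟩⟩ <;> simp only [crossR]
    exact cross_cancel s t hst false a' a'' (fun a' a'' => f (a :: a' :: a'' :: x))
  right_inv f := by
    funext x
    rcases x with _ | ⟨a, _ | ⟨a', _ | ⟨a'', x⟩⟩⟩ <;> simp only [crossR]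
    exact cross_cancel s t hst true a' a'' (fun a' a'' => f (a :: a' :: a'' :: x))

theorem perm_braid (hst : s * t = 1) :
    permL s t hst * permR s t hst * permL s t hst
      = permR s t hst * permL s t hst * permR s t hst := by
  ext f x
  rcases x with _ | ⟨⟨a, c⟩, _ | ⟨⟨a', c'⟩, _ | ⟨⟨a'', c''⟩, x⟩⟩⟩
  · rfl
  · rfl
  · rfl
  · simp only [Equiv.Perm.mul_apply, permL, permR, Equiv.coe_fn_mk, crossL, crossR]
    rcases a <;> rcases a' <;> rcases a'' <;> rcases c <;> rcases c' <;> rcases c'' <;>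
      simp [wPass, wFlip, diagW, stay, Lab.flip] <;> grind

theorem crossL_crossR (hst : s * t = 1) (b c d : Bool) (h : c = b ∨ c = d) (f : List Lab → R) :
    crossL s t b (crossR s t c (crossL s t d f))
      = crossR s t d (crossL s t c (crossR s t b f)) := by
  have key {G : Type _} [Group G] (p q : G) (hpq : p * q * p = q * p * q) :
      p⁻¹ * q⁻¹ * p⁻¹ = q⁻¹ * p⁻¹ * q⁻¹ ∧ p * q * p⁻¹ = q⁻¹ * p * q ∧ p⁻¹ * q * p = q * p * q⁻¹ ∧
        p * q⁻¹ * p⁻¹ = q⁻¹ * p⁻¹ * q ∧ p⁻¹ * q⁻¹ * p = q * p⁻¹ * q⁻¹ := by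
    have h₁ : p * q * p⁻¹ = q⁻¹ * p * q := by
      rw [mul_inv_eq_iff_eq_mul, mul_assoc, mul_assoc, eq_inv_mul_iff_mul_eq, ← mul_assoc, ← hpq,
        mul_assoc]
    have h₂ : p⁻¹ * q * p = q * p * q⁻¹ := by
      rw [eq_mul_inv_iff_mul_eq, mul_assoc, mul_assoc, inv_mul_eq_iff_eq_mul, ← mul_assoc,
        ← mul_assoc, hpq]
    refine ⟨?_, h₁, h₂, ?_, ?_⟩
    · simpa [mul_assoc] using congrArg (·⁻¹) hpq
    · simpa [mul_assoc] using congrArg (·⁻¹) h₁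
    · simpa [mul_assoc] using congrArg (·⁻¹) h₂
  have hb := perm_braid s t hst
  obtain ⟨k₁, k₂, k₃, k₄, k₅⟩ := key _ _ hb
  rcases b <;> rcases c <;> rcases d <;> simp at h
  · exact DFunLike.congr_fun k₁ f
  · exact DFunLike.congr_fun k₅ f
  · exact DFunLike.congr_fun k₃ f
  · exact DFunLike.congr_fun k₄ f
  · exact DFunLike.congr_fun k₂ f
  · exact DFunLike.congr_fun hb f

theorem eqOn_move (hst : s * t = 1) {m m' : List Slice} (h : Move m m') :
    ∀ (l l' : List Bool) (f : List Lab → R), run m l = some l' → run m' l = some l' →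
      EqOn l (ev s t m f) (ev s t m' f) := by
  induction h with
  | far e e' d => intro l l' f _ _ x _; exact far_eq s t e e' d f x
  | right h ih =>
    rename_i m m'
    intro l l' f h₁ h₂ x hx
    cases x with
    | nil =>
      simp only [List.map_nil] at hx; subst hx
      rw [run_right_nil h₁, run_right_nil h₂]
    | cons a x =>
      simp only [List.map_cons] at hx; subst hx
      rw [run_right, Option.map_eq_some_iff] at h₁ h₂
      obtain ⟨l₁, h₁, rfl⟩ := h₁
      obtain ⟨l₂, h₂, e⟩ := h₂
      obtain rfl : l₂ = l₁ := by simpa using e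
      rw [ev_right, ev_right]
      exact ih _ _ _ h₁ h₂ x rfl
  | zigzag_left o =>
    intro l l' f h₁ h₂ x hx
    subst hx
    rcases x with _ | ⟨⟨a, c⟩, x⟩
    · simp [run, Piece.actAt] at h₁
    · rcases a <;> rcases c <;> rcases o <;>
        simp [run, Piece.actAt, Piece.act] at h₁ <;>
        simp [ev, opAt, op, wBirth, wDeath, sgn] <;> grind
  | zigzag_right o =>
    intro l l' f h₁ h₂ x hx
    subst hx
    rcases x with _ | ⟨⟨a, c⟩, x⟩
    · simp [run, Piece.actAt, Piece.act] at h₁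
    · rcases a <;> rcases c <;> rcases o <;>
        simp [run, Piece.actAt, Piece.act] at h₁ <;>
        simp [ev, opAt, op, wBirth, wDeath, sgn] <;> grind
  | slide_birth o b =>
    intro l l' f h₁ h₂ x hx
    subst hx
    rcases x with _ | ⟨⟨a, c⟩, x⟩
    · simp [run, Piece.actAt] at h₁
    · rcases a <;> rcases c <;> rcases o <;> rcases b <;>
        simp [ev, opAt, op, wBirth, wPass, wFlip, diagW, stay, sgn, Lab.flip] <;> grind
  | slide_death b =>
    intro l l' f h₁ h₂ x hx
    subst hx
    rcases x with _ | ⟨⟨a, c⟩, _ | ⟨⟨a', c'⟩, _ | ⟨⟨a'', c''⟩, x⟩⟩⟩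
    · simp [run, Piece.actAt, Piece.act] at h₁
    · simp [run, Piece.actAt, Piece.act] at h₁
    · simp [run, Piece.actAt, Piece.act] at h₁
    · rcases a <;> rcases a' <;> rcases a'' <;> rcases b <;>
        simp [run, Piece.actAt, Piece.act] at h₁ <;>
        rcases c <;> rcases c' <;> rcases c'' <;>
        simp [ev, opAt, op, wDeath, wPass, wFlip, diagW, stay, sgn, Lab.flip] <;> grind
  | reidemeister_one_birth o b =>
    intro l l' f h₁ h₂ x hx
    rcases o <;> rcases b <;>
      simp [ev, opAt, op, wBirth, wPass, wFlip, diagW, stay, sgn, Lab.flip] <;> grind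
  | reidemeister_one_death b =>
    intro l l' f h₁ h₂ x hx
    subst hx
    rcases x with _ | ⟨⟨a, c⟩, _ | ⟨⟨a', c'⟩, x⟩⟩
    · simp [run, Piece.actAt, Piece.act] at h₁
    · simp [run, Piece.actAt, Piece.act] at h₁
    · rcases a <;> rcases a' <;> rcases b <;>
        simp [run, Piece.actAt, Piece.act] at h₁ <;>
        rcases c <;> rcases c' <;>
        simp [ev, opAt, op, wDeath, wPass, wFlip, diagW, stay, sgn, Lab.flip] <;> grind
  | reidemeister_two b =>
    intro l l' f h₁ h₂ x hx
    subst hx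
    rcases x with _ | ⟨a, _ | ⟨a', x⟩⟩
    · simp [run, Piece.actAt, Piece.act] at h₁
    · simp [run, Piece.actAt, Piece.act] at h₁
    · exact cross_cancel s t hst b a a' (fun a a' => f (a :: a' :: x))
  | reidemeister_three b c d h =>
    intro l l' f h₁ h₂ x hx
    subst hx
    rcases x with _ | ⟨a, _ | ⟨a', _ | ⟨a'', x⟩⟩⟩
    · simp [run, Piece.actAt, Piece.act] at h₁
    · simp [run, Piece.actAt, Piece.act] at h₁
    · simp [run, Piece.actAt, Piece.act] at h₁
    · exact congrFun (crossL_crossR s t hst b c d h f) (a :: a' :: a'' :: x)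


def inter (κ : Bool) : (List Lab → R) → List Lab → R
  | _, [] => 0
  | f, a :: x =>
    (if (a.2 == a.1) = κ then (if a.1 then 1 else if κ then s else -s) * f (a.flip :: x) else 0)
      + (if a.1 then t else s) * sgn R a.2 * inter κ (fun y => f (a :: y)) x

theorem inter_lin (κ : Bool) (c d : R) (f g : List Lab → R) (x : List Lab) :
    inter s t κ (fun y => c * f y + d * g y) x
      = c * inter s t κ f x + d * inter s t κ g x := by
  induction x generalizing f g with
  | nil => simp [inter]
  | cons a x ih =>
    simp only [inter, ih]
    split_ifs <;> ring

theorem inter_zero (κ : Bool) (x : List Lab) : inter s t κ (fun _ => 0) x = 0 := by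
  simpa using inter_lin s t κ 0 0 (fun _ => 0) (fun _ => 0) x

def lowW (κ : Bool) (a : Lab) : R :=
  if (a.2 == a.1) = κ then (if a.1 then 1 else if κ then s else -s) else 0
def tailW (a : Lab) : R := (if a.1 then t else s) * sgn R a.2

theorem inter_cons (κ : Bool) (f : List Lab → R) (a : Lab) (x : List Lab) :
    inter s t κ f (a :: x) = lowW s κ a * f (a.flip :: x)
      + tailW s t a * inter s t κ (fun y => f (a :: y)) x := by
  simp only [inter, lowW, tailW, ite_mul, zero_mul]

set_option maxHeartbeats 2000000 in
theorem inter_cross_aux (hst : s * t = 1) (κ b : Bool) (a a' : Lab) (f g : Lab → Lab → R) :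
    lowW s κ a * (wPass s t b a.flip a' * f a' a.flip + wFlip s t b a.flip a' * f a'.flip a)
      + tailW s t a * (lowW s κ a' *
          (wPass s t b a a'.flip * f a'.flip a + wFlip s t b a a'.flip * f a' a.flip)
        + tailW s t a' * (wPass s t b a a' * g a' a + wFlip s t b a a' * g a'.flip a.flip))
    = wPass s t b a a' * (lowW s κ a' * f a'.flip a
        + tailW s t a' * (lowW s κ a * f a' a.flip + tailW s t a * g a' a))
      + wFlip s t b a a' * (lowW s κ a'.flip * f a' a.flip
        + tailW s t a'.flip * (lowW s κ a.flip * f a'.flip a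
          + tailW s t a.flip * g a'.flip a.flip)) := by
  obtain ⟨a, c⟩ := a
  obtain ⟨a', c'⟩ := a'
  rcases a <;> rcases a' <;> rcases b <;> rcases c <;> rcases c' <;> rcases κ <;>
    simp [lowW, tailW, wPass, wFlip, diagW, stay, sgn, Lab.flip] <;> grind

theorem flip_flip (a : Lab) : a.flip.flip = a := by simp [Lab.flip]

theorem inter_cross (hst : s * t = 1) (κ b : Bool) (a a' : Lab) (f : List Lab → R)
    (x : List Lab) : inter s t κ (op s t (.cross b) f) (a :: a' :: x)
      = op s t (.cross b) (inter s t κ f) (a :: a' :: x) := by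
  have h := inter_lin s t κ (wPass s t b a a') (wFlip s t b a a')
    (fun x => f (a' :: a :: x)) (fun x => f (a'.flip :: a.flip :: x)) x
  simp only [inter_cons, op]
  rw [h]
  have := inter_cross_aux s t hst κ b a a' (fun a a' => f (a :: a' :: x))
    (fun a a' => inter s t κ (fun x => f (a :: a' :: x)) x)
  simpa only [flip_flip] using this

theorem inter_op (hst : s * t = 1) (κ : Bool) (e : Piece) (f : List Lab → R) (x : List Lab) :
    inter s t κ (op s t e f) x = op s t e (inter s t κ f) x := by
  cases e with
  | birth o =>
    have h := inter_lin s t κ (wBirth t o false) (wBirth t o true)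
      (fun x => f ((o, false) :: (!o, false) :: x)) (fun x => f ((o, true) :: (!o, true) :: x)) x
    refine Eq.trans h ?_
    simp only [op]
    rcases o <;> rcases κ <;> simp [inter, wBirth, sgn, Lab.flip] <;> grind
  | death =>
    rcases x with _ | ⟨⟨a, c⟩, _ | ⟨⟨a', c'⟩, x⟩⟩
    · simp [op, inter]
    · simp [op, inter]
    · have h := inter_lin s t κ (wDeath s a c) 0 f f x
      simp only [zero_mul, add_zero] at h
      have h0 := inter_zero s t κ x
      rcases a <;> rcases a' <;> rcases c <;> rcases c' <;> rcases κ <;>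
        simp [op, inter, wDeath, sgn, Lab.flip] at h ⊢ <;> grind
  | cross b =>
    rcases x with _ | ⟨⟨a, c⟩, _ | ⟨⟨a', c'⟩, x⟩⟩
    · simp [op, inter]
    · simp [op, inter]
    · exact inter_cross s t hst κ b (a, c) (a', c') f x

theorem inter_opAt (hst : s * t = 1) (κ : Bool) (e : Piece) (i : ℕ) (f : List Lab → R)
    (x : List Lab) : inter s t κ (opAt s t e i f) x = opAt s t e i (inter s t κ f) x := by
  induction i generalizing f x with
  | zero => exact inter_op s t hst κ e f x
  | succ i ih =>
    cases x with
    | nil => simp [inter, opAt]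
    | cons a x =>
      simp only [inter, opAt, ih]
      by_cases h : (a.2 == a.1) = κ
      · simp only [h, if_true]
        exact (opAt_lin s t e _ _ i (fun y => f (a.flip :: y)) _ x).symm
      · simp only [h, if_false, zero_add]
        have := opAt_lin s t e 0 ((if a.1 then t else s) * sgn R a.2) i f
          (inter s t κ (fun y => f (a :: y))) x
        simpa using this.symm

def vac : List Lab → R
  | [] => 1
  | _ => 0

theorem inter_ev (hst : s * t = 1) (κ : Bool) (w : List Slice) (x : List Lab) :
    inter s t κ (ev s t w vac) x = 0 := by
  have h0 : ∀ x, inter s t κ (vac : List Lab → R) x = 0 := by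
    intro x
    cases x with
    | nil => rfl
    | cons a x =>
      have : (fun y => (vac (a :: y) : R)) = fun _ => 0 := rfl
      simp only [inter, this, inter_zero]
      simp [vac]
  induction w generalizing x with
  | nil => exact h0 x
  | cons p w ih =>
    obtain ⟨i, e⟩ := p
    simp only [ev, inter_opAt s t hst]
    rw [show inter s t κ (ev s t w vac) = fun _ => 0 from funext ih]
    simpa using opAt_lin s t e 0 0 i (fun _ => 0) (fun _ => 0) x

def firstW (o : Bool) : R := if o then 1 else t

def alex : List Slice → R
  | (_, .birth o) :: w => firstW t o * ev s t w vac [(o, false), (!o, false)]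
  | _ => 0

theorem inter_two_births (hst : s * t = 1) (o o' : Bool) (g : List Lab → R)
    (h : ∀ κ x, inter s t κ g x = 0) :
    firstW t o * op s t (.birth o') (fun x => g ((o, false) :: (!o, false) :: x)) []
      = firstW t o' * op s t (.birth o) g [(o', false), (!o', false)] := by
  have h₁ := h true
  have h₂ := h false
  rcases o <;> rcases o'
  · have e₁ := h₁ [(false, false), (true, false), (false, false), (true, true)]
    have e₂ := h₁ [(false, false), (true, true), (false, false), (true, false)]
    have e₅ := h₂ [(false, true), (true, false), (false, false), (true, false)]
    simp [inter, sgn, Lab.flip] at e₁ e₂ e₅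
    simp [firstW, op, wBirth]
    grind
  · have e₁ := h₁ [(false, false), (true, false), (true, true), (false, false)]
    have e₂ := h₁ [(false, false), (true, true), (true, false), (false, false)]
    have e₅ := h₂ [(false, true), (true, false), (true, false), (false, false)]
    simp [inter, sgn, Lab.flip] at e₁ e₂ e₅
    simp [firstW, op, wBirth, sgn]
    grind
  · have e₁ := h₁ [(true, true), (false, false), (false, false), (true, false)]
    have e₂ := h₁ [(true, false), (false, false), (false, false), (true, true)]
    have e₅ := h₂ [(true, false), (false, true), (false, false), (true, false)]
    simp [inter, sgn, Lab.flip] at e₁ e₂ e₅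
    simp [firstW, op, wBirth, sgn]
    grind
  · have e₁ := h₁ [(true, true), (false, false), (true, false), (false, false)]
    have e₂ := h₁ [(true, false), (false, false), (true, true), (false, false)]
    have e₅ := h₂ [(true, false), (false, true), (true, false), (false, false)]
    simp [inter, sgn, Lab.flip] at e₁ e₂ e₅
    simp [firstW, op, wBirth, sgn]
    grind

theorem alex_two_births (hst : s * t = 1) (o o' : Bool) (w : List Slice) :
    alex s t ((0, .birth o) :: (2, .birth o') :: w)
      = alex s t ((0, .birth o') :: (0, .birth o) :: w) :=
  inter_two_births s t hst o o' (ev s t w vac) (fun κ => inter_ev s t hst κ w)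

theorem alex_kink (hst : s * t = 1) (o b : Bool) (w : List Slice) :
    alex s t ((0, .birth o) :: (0, .cross b) :: w) = alex s t ((0, .birth (!o)) :: w) := by
  have h := inter_ev s t hst true w
  simp only [alex, ev, opAt, op]
  generalize ev s t w vac = g at h ⊢
  rcases o
  · have e := h [(true, true), (false, false)]
    rcases b <;> simp [inter, sgn, firstW, wPass, wFlip, diagW, stay, Lab.flip] at e ⊢ <;> grind
  · have e := h [(false, false), (true, true)]
    rcases b <;> simp [inter, sgn, firstW, wPass, wFlip, diagW, stay, Lab.flip] at e ⊢ <;> grind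

theorem run_cons_nil {p : Slice} {w : List Slice} {l : List Bool}
    (h : run (p :: w) [] = some l) :
    ∃ o, p = (0, .birth o) ∧ run w [o, !o] = some l := by
  obtain ⟨i, e⟩ := p
  cases i with
  | succ i => simp [run, Piece.actAt] at h
  | zero =>
    cases e with
    | birth o => exact ⟨o, rfl, by simpa [run, Piece.actAt, Piece.act] using h⟩
    | death => simp [run, Piece.actAt, Piece.act] at h
    | cross b => simp [run, Piece.actAt, Piece.act] at h

theorem alex_move_nil (hst : s * t = 1) {m m' : List Slice} (hm : Move m m') (v : List Slice)
    (l l' : List Bool) (h : run m [] = some l) (h' : run m' [] = some l') :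
    alex s t (m ++ v) = alex s t (m' ++ v) := by
  cases hm with
  | far e e' d =>
    obtain ⟨o, h₁, -⟩ := run_cons_nil h
    obtain ⟨o', h₂, -⟩ := run_cons_nil h'
    simp only [Prod.mk.injEq, true_and] at h₁ h₂
    obtain ⟨h₂, rfl⟩ := h₂
    subst h₁
    obtain rfl : d = 0 := by simpa [Piece.tops] using h₂
    exact alex_two_births s t hst o o' v
  | zigzag_left o => obtain ⟨o, h₁, -⟩ := run_cons_nil h; simp at h₁
  | zigzag_right o =>
    simp [run, Piece.actAt, Piece.act] at h
  | slide_birth o b => obtain ⟨o, h₁, -⟩ := run_cons_nil h; simp at h₁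
  | slide_death b => obtain ⟨o, h₁, -⟩ := run_cons_nil h; simp at h₁
  | reidemeister_one_birth o b => exact alex_kink s t hst o b v
  | reidemeister_one_death b => obtain ⟨o, h₁, -⟩ := run_cons_nil h; simp at h₁
  | reidemeister_two b => obtain ⟨o, h₁, -⟩ := run_cons_nil h; simp at h₁
  | reidemeister_three b c d hb => obtain ⟨o, h₁, -⟩ := run_cons_nil h; simp at h₁
  | right hm => rw [run_right_nil h, run_right_nil h']

theorem run_append_some {u v : List Slice} {l l' : List Bool}
    (h : run (u ++ v) l = some l') : ∃ l₁, run u l = some l₁ ∧ run v l₁ = some l' := by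
  rwa [run_append, Option.bind_eq_some_iff] at h

theorem alex_append {u : List Slice} (hu : u ≠ []) {l : List Bool} (h : run u [] = some l) :
    ∃ o : Bool, ∃ u' : List Slice, run u' [o, !o] = some l ∧
      ∀ v, alex s t (u ++ v) = firstW t o * ev s t u' (ev s t v vac) [(o, false), (!o, false)] := by
  cases u with
  | nil => exact absurd rfl hu
  | cons p u =>
    obtain ⟨o, rfl, h₁⟩ := run_cons_nil h
    exact ⟨o, u, h₁, fun v => by simp only [List.cons_append, alex, ev_append]⟩

end StateSum

theorem move_run {m m' : List Slice} (h : Move m m') : ∀ (l l₁ l₂ : List Bool),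
    run m l = some l₁ → run m' l = some l₂ → l₁ = l₂ := by
  induction h with
  | right h ih =>
    intro l l₁ l₂ h₁ h₂
    cases l with
    | nil =>
      rw [run_right_nil h₁] at h₁
      rw [run_right_nil h₂] at h₂
      simpa [run] using h₁.symm.trans h₂
    | cons a l =>
      rw [run_right, Option.map_eq_some_iff] at h₁ h₂
      obtain ⟨l₁, h₁, rfl⟩ := h₁
      obtain ⟨l₂, h₂, rfl⟩ := h₂
      rw [ih _ _ _ h₁ h₂]
  | far e e' d =>
    intro l l₁ l₂ h₁ h₂
    cases e with
    | birth o =>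
      simp only [run, Piece.bottoms, Piece.tops, Nat.zero_add, Nat.add_comm 2 d, Piece.actAt,
        Piece.act, Option.bind_some, Option.bind_fun_some] at h₁ h₂
      cases h : e'.actAt d l <;> simp_all
    | death =>
      rcases l with _ | ⟨a, _ | ⟨b, l⟩⟩
      · simp [run, Piece.actAt, Piece.act] at h₁
      · simp [run, Piece.actAt, Piece.act] at h₁
      · simp only [run, Piece.bottoms, Piece.tops, Nat.zero_add, Nat.add_comm 2 d, Piece.actAt,
          Piece.act] at h₁ h₂
        cases h : e'.actAt d l <;> by_cases hb : b = !a <;> simp_all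
    | cross c =>
      rcases l with _ | ⟨a, _ | ⟨b, l⟩⟩
      · simp [run, Piece.actAt, Piece.act] at h₁
      · simp [run, Piece.actAt, Piece.act] at h₁
      · simp only [run, Piece.bottoms, Piece.tops, Nat.add_comm 2 d, Piece.actAt,
          Piece.act] at h₁ h₂
        cases h : e'.actAt d l <;> simp_all [Piece.actAt]
  | zigzag_left o =>
    intro l l₁ l₂ h₁ h₂
    rcases l with _ | ⟨a, l⟩
    · simp [run, Piece.actAt] at h₁
    · simp [run, Piece.actAt, Piece.act] at h₁ h₂
      obtain ⟨rfl, rfl⟩ := h₁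
      simpa using h₂
  | zigzag_right o =>
    intro l l₁ l₂ h₁ h₂
    rcases l with _ | ⟨a, l⟩
    · simp [run, Piece.actAt, Piece.act] at h₁
    · simp [run, Piece.actAt, Piece.act] at h₁ h₂; grind
  | slide_birth o b =>
    intro l l₁ l₂ h₁ h₂
    rcases l with _ | ⟨a, l⟩
    · simp [run, Piece.actAt] at h₁
    · simp [run, Piece.actAt, Piece.act] at h₁ h₂; grind
  | slide_death b =>
    intro l l₁ l₂ h₁ h₂
    rcases l with _ | ⟨a, _ | ⟨a', _ | ⟨a'', l⟩⟩⟩ <;>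
      simp [run, Piece.actAt, Piece.act] at h₁ h₂
    grind
  | reidemeister_one_birth o b =>
    intro l l₁ l₂ h₁ h₂
    simp [run, Piece.actAt, Piece.act] at h₁ h₂; grind
  | reidemeister_one_death b =>
    intro l l₁ l₂ h₁ h₂
    rcases l with _ | ⟨a, _ | ⟨a', l⟩⟩ <;> simp [run, Piece.actAt, Piece.act] at h₁ h₂
    grind
  | reidemeister_two b =>
    intro l l₁ l₂ h₁ h₂
    rcases l with _ | ⟨a, _ | ⟨a', l⟩⟩ <;> simp [run, Piece.actAt, Piece.act] at h₁ h₂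
    grind
  | reidemeister_three b c d h =>
    intro l l₁ l₂ h₁ h₂
    rcases l with _ | ⟨a, _ | ⟨a', _ | ⟨a'', l⟩⟩⟩ <;>
      simp [run, Piece.actAt, Piece.act] at h₁ h₂
    grind

theorem eqOn_skein {R : Type*} [CommRing R] (s t : R) (f : List Lab → R)
    (l l' : List Bool) (o : Bool) (x : List Lab) (hx : x.map Prod.fst = l ++ o :: o :: l') :
    opAt s t (.cross true) l.length f x
      = 1 * opAt s t (.cross false) l.length f x + (t - s) * f x := by
  induction l generalizing f x with
  | nil =>
    rcases x with _ | ⟨⟨a, c⟩, _ | ⟨⟨a', c'⟩, x⟩⟩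
    · simp at hx
    · simp at hx
    · simp only [List.nil_append, List.map_cons, List.cons.injEq] at hx
      obtain ⟨h₁, h₂, -⟩ := hx
      change a = o at h₁
      change a' = o at h₂
      subst h₁
      subst h₂
      rcases a' <;> rcases c <;> rcases c' <;>
        simp [opAt, op, wPass, wFlip, diagW, stay, Lab.flip] <;> ring
  | cons b l ih =>
    cases x with
    | nil => simp at hx
    | cons a x =>
      simp only [List.cons_append, List.map_cons, List.cons.injEq] at hx
      exact ih (fun y => f (a :: y)) x hx.2

theorem alex_isotopy {R : Type*} [CommRing R] (s t : R) (hst : s * t = 1) (D D' : LinkDiagram)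
    (h : ElementaryIsotopy D D') : alex s t D.word = alex s t D'.word := by
  obtain ⟨u, m, m', v, hm, hD, hD'⟩ := h
  have c := D.closed
  have c' := D'.closed
  rw [hD, List.append_assoc] at c ⊢
  rw [hD', List.append_assoc] at c' ⊢
  obtain ⟨l, hl, c⟩ := run_append_some c
  obtain ⟨l', hl', c'⟩ := run_append_some c'
  obtain rfl : l' = l := by simpa using hl'.symm.trans hl
  obtain ⟨l₁, h₁, c⟩ := run_append_some c
  obtain ⟨l₂, h₂, c'⟩ := run_append_some c'
  obtain rfl := move_run hm _ _ _ h₁ h₂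
  by_cases hu : u = []
  · subst hu
    obtain rfl : [] = l' := by simpa [run] using hl
    exact alex_move_nil s t hst hm v l₁ l₁ h₁ h₂
  · obtain ⟨o, u', hu', e⟩ := alex_append s t hu hl
    rw [e, e, ev_append, ev_append]
    rw [ev_congr s t u' _ _ _ _ hu' (eqOn_move s t hst hm _ _ (ev s t v vac) h₁ h₂) _ rfl]

theorem alex_skein {R : Type*} [CommRing R] (s t : R) (Dp D0 Dm : LinkDiagram)
    (h : SkeinTriple Dp D0 Dm) :
    alex s t Dm.word = alex s t Dp.word + (t - s) * alex s t D0.word := by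
  obtain ⟨u, v, l, l', o, hu, hp, h0, hm⟩ := h
  have hne : u ≠ [] := by
    rintro rfl
    simp [run] at hu
  obtain ⟨o', u', hu', e⟩ := alex_append s t hne hu
  rw [hp, h0, hm, e, e, e]
  have := ev_congr s t u' _ _ (ev s t ((l.length, .cross true) :: v) vac)
    (fun x => 1 * ev s t ((l.length, .cross false) :: v) vac x + (t - s) * ev s t v vac x) hu'
    (fun x hx => eqOn_skein s t (ev s t v vac) l l' o x hx) [(o', false), (!o', false)] rfl
  rw [this, ev_lin]
  ring

theorem exists_isAlexanderConway : ∃ f, IsAlexanderConway f := by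
  have hst : (LaurentPolynomial.T 1 : LaurentPolynomial ℂ) * LaurentPolynomial.T (-1) = 1 := by
    rw [← LaurentPolynomial.T_add]; simp
  refine ⟨fun D => alex (LaurentPolynomial.T 1) (LaurentPolynomial.T (-1)) D.word, ?_, ?_, ?_⟩
  · intro D D' h
    induction h with
    | rel D D' h => exact alex_isotopy _ _ hst D D' h
    | refl => rfl
    | symm _ _ _ ih => exact ih.symm
    | trans _ _ _ _ _ ih₁ ih₂ => exact ih₁.trans ih₂
  · simp [unknot, alex, firstW, ev, opAt, op, wDeath, vac]
  · intro Dp D0 Dm h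
    simp only [alex_skein _ _ Dp D0 Dm h]
    ring

/-- The Alexander-Conway polynomial: the function on oriented link diagrams with the properties
`IsAlexanderConway`. -/
noncomputable def alexanderConway : LinkDiagram → LaurentPolynomial ℂ :=
  Classical.choose exists_isAlexanderConway

theorem alexanderConway_spec : IsAlexanderConway alexanderConway :=
  Classical.choose_spec exists_isAlexanderConway

/-! ### Braids and their closures -/

/-- Artin's relations for the generators `x_0, …, x_{n-2}` of the braid group on `n` strands. -/
def artinRelations (n : ℕ) : Set (FreeGroup (Fin (n - 1))) :=
  {r | ∃ i j : Fin (n - 1), (i : ℕ) + 1 < j ∧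
      r = .of i * .of j * (.of i)⁻¹ * (.of j)⁻¹} ∪
  {r | ∃ i j : Fin (n - 1), (i : ℕ) + 1 = j ∧
      r = .of i * .of j * .of i * (.of j * .of i * .of j)⁻¹}

/-- The braid group on `n` strands. -/
abbrev BraidGroup (n : ℕ) := PresentedGroup (artinRelations n)

/-- The Artin generator that exchanges the strands `i` and `i + 1`. -/
def braidGen {n : ℕ} (i : Fin (n - 1)) : BraidGroup n := PresentedGroup.of i

/-- Words in the Artin generators (`true`) and their inverses (`false`). -/
abbrev BraidWord (n : ℕ) := List (Fin (n - 1) × Bool)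

/-- The braid that a word represents. -/
def BraidWord.toBraid {n : ℕ} (w : BraidWord n) : BraidGroup n :=
  PresentedGroup.mk (artinRelations n) (FreeGroup.mk w)

theorem BraidWord.toBraid_surjective {n : ℕ} (β : BraidGroup n) :
    ∃ w : BraidWord n, w.toBraid = β := by
  obtain ⟨g, rfl⟩ := PresentedGroup.mk_surjective (artinRelations n) β
  exact ⟨g.toWord, by rw [BraidWord.toBraid, FreeGroup.mk_toWord]⟩

/-- `n` nested maxima; `n` strands go down at the left and `n` strands go up at the right. -/
def openStrands (n : ℕ) : List Slice := (List.range n).map fun i => (i, .birth true)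
/-- `n` nested minima. -/
def closeStrands (n : ℕ) : List Slice := (List.range n).reverse.map fun i => (i, .death)
/-- The slices of a braid word: the generator `x_i` is a crossing in which the strand from upper
left to lower right passes over, and its inverse is the opposite crossing. -/
def BraidWord.slices {n : ℕ} (w : BraidWord n) : List Slice :=
  w.map fun x => ((x.1 : ℕ), .cross x.2)

/-- The braid `x_{i_0}^{a_0} x_{i_1}^{a_1} ⋯ x_{i_{k-1}}^{a_{k-1}}`. -/
def braidMonomial {n k : ℕ} (i : Fin k → Fin (n - 1)) (a : Fin k → ℤ) : BraidGroup n :=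
  (List.ofFn fun m => braidGen (i m) ^ a m).prod

theorem actAt_append (e : Piece) (l l' : List Bool) :
    e.actAt l.length (l ++ l') = (e.act l').map (l ++ ·) := by
  induction l with
  | nil => simp [Piece.actAt]
  | cons a l ih =>
    simp only [List.length_cons, List.cons_append, Piece.actAt, ih, Option.map_map]
    rfl

theorem run_openStrands (n : ℕ) :
    run (openStrands n) [] = some (List.replicate n true ++ List.replicate n false) := by
  induction n with
  | zero => rfl
  | succ n ih =>
    have h := actAt_append (.birth true) (List.replicate n true) (List.replicate n false)
    rw [List.length_replicate] at h
    rw [openStrands, List.range_succ, List.map_append, run_append]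
    change (run (openStrands n) []).bind _ = _
    rw [ih]
    simp only [Option.bind_some, List.map_cons, List.map_nil, run, h, Piece.act, Option.map_some,
      List.replicate_succ' (a := true), List.append_assoc]
    rfl

theorem run_closeStrands (n : ℕ) :
    run (closeStrands n) (List.replicate n true ++ List.replicate n false) = some [] := by
  induction n with
  | zero => rfl
  | succ n ih =>
    have h := actAt_append .death (List.replicate n true) (true :: List.replicate (n + 1) false)
    rw [List.length_replicate] at h
    rw [closeStrands, List.range_succ, List.reverse_append, List.map_append, run_append]
    simp only [List.reverse_singleton, List.map_cons, List.map_nil, run,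
      List.replicate_succ' (a := true), List.append_assoc, List.singleton_append, h]
    simpa [Piece.act, List.replicate_succ, closeStrands] using ih

theorem actAt_cross_parallel (b : Bool) (l l' : List Bool) (o : Bool) :
    (Piece.cross b).actAt l.length (l ++ o :: o :: l') = some (l ++ o :: o :: l') := by
  rw [actAt_append]; rfl

theorem run_slices {n : ℕ} (w : BraidWord n) :
    run w.slices (List.replicate n true ++ List.replicate n false)
      = some (List.replicate n true ++ List.replicate n false) := by
  induction w with
  | nil => rfl
  | cons x w ih =>
    obtain ⟨i, b⟩ := x
    obtain ⟨d, hd⟩ : ∃ d, n = i + (d + 2) := ⟨n - i - 2, by omega⟩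
    have e : List.replicate n true ++ List.replicate n false
        = List.replicate i true ++ true :: true ::
          (List.replicate d true ++ List.replicate n false) := by
      conv_lhs => rw [hd, ← List.replicate_append_replicate]
      simp [List.replicate_succ, ← hd]
    have h := actAt_cross_parallel b (List.replicate i true)
      (List.replicate d true ++ List.replicate n false) true
    rw [List.length_replicate, ← e] at h
    change ((Piece.cross b).actAt i _).bind (run (BraidWord.slices w)) = _
    rw [h]
    exact ih

/-- The closure of a braid word, all strands of the braid being oriented downwards. -/
def BraidWord.closure {n : ℕ} (w : BraidWord n) : LinkDiagram where
  word := openStrands n ++ w.slices ++ closeStrands n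
  closed := by
    rw [run_append, run_append, run_openStrands, Option.bind_some, run_slices, Option.bind_some,
      run_closeStrands]

theorem Move.shift {m m' : List Slice} (h : Move m m') (i : ℕ) :
    Move (m.map fun x => (x.1 + i, x.2)) (m'.map fun x => (x.1 + i, x.2)) := by
  induction i with
  | zero => simpa using h
  | succ i ih => simpa [Slice.right, Function.comp_def, Nat.add_assoc] using ih.right

theorem closure_congr {n : ℕ} {w w' : BraidWord n} (h : Move w.slices w'.slices)
    (u v : BraidWord n) : alexanderConway (BraidWord.closure (u ++ w ++ v))
      = alexanderConway (BraidWord.closure (u ++ w' ++ v)) :=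
  alexanderConway_spec.isotopy _ _ (.rel _ _
    ⟨openStrands n ++ u.slices, w.slices, w'.slices, v.slices ++ closeStrands n, h,
      by simp [BraidWord.closure, BraidWord.slices], by simp [BraidWord.closure, BraidWord.slices]⟩)

/-- Functions on braid words that do not change under local moves. -/
def BraidInvariant (n : ℕ) := {φ : BraidWord n → LaurentPolynomial ℂ //
  ∀ w w' : BraidWord n, Move w.slices w'.slices → ∀ u v, φ (u ++ w ++ v) = φ (u ++ w' ++ v)}

def BraidInvariant.letter {n : ℕ} (x : Fin (n - 1) × Bool) (φ : BraidInvariant n) :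
    BraidInvariant n :=
  ⟨fun u => φ.1 (u ++ [x]), fun w w' h u v => by
    simpa only [List.append_assoc] using φ.2 w w' h u (v ++ [x])⟩

theorem BraidInvariant.letter_cancel {n : ℕ} (i : Fin (n - 1)) (b : Bool) (φ : BraidInvariant n) :
    letter (i, b) (letter (i, !b) φ) = φ := by
  refine Subtype.ext (funext fun u => ?_)
  have h := (Move.reidemeister_two b).shift i
  simpa [letter] using φ.2 [(i, b), (i, !b)] [] (by simpa [BraidWord.slices] using h) u []

def BraidInvariant.perm {n : ℕ} (i : Fin (n - 1)) : Equiv.Perm (BraidInvariant n) where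
  toFun := letter (i, true)
  invFun := letter (i, false)
  left_inv φ := letter_cancel i false φ
  right_inv φ := letter_cancel i true φ

theorem BraidInvariant.perm_relations {n : ℕ} : ∀ r ∈ artinRelations n,
    FreeGroup.lift (BraidInvariant.perm (n := n)) r = 1 := by
  rintro r (⟨i, j, hij, rfl⟩ | ⟨i, j, hij, rfl⟩)
  · simp only [map_mul, map_inv, FreeGroup.lift_apply_of]
    rw [mul_inv_eq_one, mul_inv_eq_iff_eq_mul]
    ext φ : 1
    refine Subtype.ext (funext fun u => ?_)
    obtain ⟨d, hd⟩ := Nat.exists_eq_add_of_lt hij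
    have h := (Move.far (.cross true) (.cross true) d).shift i
    have := φ.2 [(i, true), (j, true)] [(j, true), (i, true)]
      (by
        convert h using 1 <;> simp [BraidWord.slices, Piece.tops, Piece.bottoms] <;> omega) u []
    simpa [Equiv.Perm.mul_apply, perm, letter] using this
  · simp only [map_mul, map_inv, FreeGroup.lift_apply_of]
    rw [mul_inv_eq_one]
    ext φ : 1
    refine Subtype.ext (funext fun u => ?_)
    have h := (Move.reidemeister_three true true true (.inl rfl)).shift i
    have := φ.2 [(i, true), (j, true), (i, true)] [(j, true), (i, true), (j, true)]
      (by
        convert h using 1 <;> simp [BraidWord.slices] <;> omega) u []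
    simp only [List.append_nil] at this
    simp only [Equiv.Perm.mul_apply]
    change φ.1 (((u ++ [(i, true)]) ++ [(j, true)]) ++ [(i, true)])
      = φ.1 (((u ++ [(j, true)]) ++ [(i, true)]) ++ [(j, true)])
    simpa using this

theorem BraidInvariant.lift_apply {n : ℕ} (w : BraidWord n) (φ : BraidInvariant n)
    (u : BraidWord n) :
    (FreeGroup.lift (BraidInvariant.perm (n := n)) (FreeGroup.mk w) φ).1 u = φ.1 (u ++ w) := by
  rw [FreeGroup.lift_mk]
  induction w generalizing u with
  | nil => simp
  | cons x w ih =>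
    obtain ⟨i, b⟩ := x
    rw [List.map_cons, List.prod_cons, Equiv.Perm.mul_apply]
    have key : ∀ ψ : BraidInvariant n,
        ((bif b then perm i else (perm i)⁻¹ : Equiv.Perm (BraidInvariant n)) ψ).1 u
          = ψ.1 (u ++ [(i, b)]) := by
      intro ψ; cases b <;> rfl
    refine (key _).trans ?_
    rw [ih]
    simp

/-- The Alexander-Conway polynomial of the closure of a braid, computed from any braid word that
represents it; see `conwayOfBraid_toBraid` for the independence of the word. -/
noncomputable def conwayOfBraid {n : ℕ} (β : BraidGroup n) : LaurentPolynomial ℂ :=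
  alexanderConway (Classical.choose (BraidWord.toBraid_surjective β)).closure

theorem conwayOfBraid_toBraid {n : ℕ} (w : BraidWord n) :
    conwayOfBraid w.toBraid = alexanderConway w.closure := by
  let φ : BraidInvariant n := ⟨fun w => alexanderConway (BraidWord.closure w),
    fun w w' h u v => closure_congr h u v⟩
  have key (v : BraidWord n) : alexanderConway v.closure
      = (PresentedGroup.toGroup BraidInvariant.perm_relations v.toBraid φ).1 [] := by
    have : PresentedGroup.toGroup BraidInvariant.perm_relations v.toBraid
        = FreeGroup.lift (BraidInvariant.perm (n := n)) (FreeGroup.mk v) := rfl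
    rw [this, BraidInvariant.lift_apply]
    rfl
  rw [conwayOfBraid, key, key, Classical.choose_spec (BraidWord.toBraid_surjective w.toBraid)]

/-! ### Diagrams with boxes -/

/-- A box with `i` strands to the left of it contains two strands with the same direction; the
orientations above and below are the same. -/
def boxAct : ℕ → List Bool → Option (List Bool)
  | 0, a :: b :: l => if a = b then some (a :: b :: l) else none
  | i + 1, a :: l => (boxAct i l).map (a :: ·)
  | _, _ => none

/-- The orientations below a sequence of slices and boxes, in terms of those above it. -/
def runBoxes {p : ℕ} : List (Slice ⊕ ℕ × Fin p) → List Bool → Option (List Bool)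
  | [], l => some l
  | .inl (i, e) :: w, l => (e.actAt i l).bind (runBoxes w)
  | .inr (i, _) :: w, l => (boxAct i l).bind (runBoxes w)

/-- A link diagram with `p` boxes `R_0, …, R_{p-1}`, each of them met by two strands with the same
direction; the second component of a box `(i, j)` is its index. -/
structure TwistFamily (p : ℕ) where
  word : List (Slice ⊕ ℕ × Fin p)
  closed : runBoxes word [] = some []
  once : ∀ j : Fin p, (word.filterMap (Sum.elim (fun _ => none) fun x => some x.2)).count j = 1

/-- The 2-braid `x_1 ^ a`, with `i` strands to the left of it: `|a|` equal crossings. -/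
def twist (i : ℕ) (a : ℤ) : List Slice := List.replicate a.natAbs (i, .cross (decide (0 ≤ a)))

/-- The box with index `j` is replaced by the 2-braid `x_1 ^ (k j)`. -/
def fillBoxes {p : ℕ} (k : Fin p → ℤ) : List (Slice ⊕ ℕ × Fin p) → List Slice
  | [] => []
  | .inl x :: w => x :: fillBoxes k w
  | .inr (i, j) :: w => twist i (k j) ++ fillBoxes k w

theorem boxAct_eq {i : ℕ} {l l' : List Bool} (h : boxAct i l = some l') (b : Bool) :
    l' = l ∧ (Piece.cross b).actAt i l = some l := by
  induction i generalizing l l' with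
  | zero =>
    rcases l with _ | ⟨a, _ | ⟨a', l⟩⟩ <;> simp [boxAct] at h
    obtain ⟨rfl, rfl⟩ := h
    simp [Piece.actAt, Piece.act]
  | succ i ih =>
    cases l with
    | nil => simp [boxAct] at h
    | cons a l =>
      simp only [boxAct, Option.map_eq_some_iff] at h
      obtain ⟨l₁, h, rfl⟩ := h
      obtain ⟨rfl, h⟩ := ih h
      simp [Piece.actAt, h]

theorem run_twist {i : ℕ} {l l' : List Bool} (h : boxAct i l = some l') (a : ℤ) :
    run (twist i a) l = some l' := by
  obtain ⟨rfl, h⟩ := boxAct_eq h (decide (0 ≤ a))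
  rw [twist]
  induction a.natAbs with
  | zero => rfl
  | succ m ih => simp only [List.replicate_succ, run, h, Option.bind_some, ih]

theorem run_fillBoxes {p : ℕ} (k : Fin p → ℤ) (w : List (Slice ⊕ ℕ × Fin p)) :
    ∀ l l' : List Bool, runBoxes w l = some l' → run (fillBoxes k w) l = some l' := by
  induction w with
  | nil => exact fun l l' h => h
  | cons x w ih =>
    intro l l' h
    rcases x with ⟨i, e⟩ | ⟨i, j⟩
    · simp only [runBoxes, Option.bind_eq_some_iff] at h
      obtain ⟨l₁, h₁, h₂⟩ := h
      simp only [fillBoxes, run, h₁, Option.bind_some, ih _ _ h₂]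
    · simp only [runBoxes, Option.bind_eq_some_iff] at h
      obtain ⟨l₁, h₁, h₂⟩ := h
      simp only [fillBoxes, run_append, run_twist h₁, Option.bind_some, ih _ _ h₂]

/-- The link diagram `L(R_{k_1}, …, R_{k_p})`. -/
def TwistFamily.fill {p : ℕ} (L : TwistFamily p) (k : Fin p → ℤ) : LinkDiagram where
  word := fillBoxes k L.word
  closed := run_fillBoxes k L.word _ _ L.closed

open LaurentPolynomial in
/-- The Laurent polynomial `C^a(s) = (-1)^a s^(a-1) + s^(1-a)`. -/
noncomputable def expansionCoeff (a : ℤ) : LaurentPolynomial ℂ :=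
  C ((-1) ^ a) * T (a - 1) + T (1 - a)

/-- Laurent polynomials as elements of the field of rational functions in `s`. -/
noncomputable def toRational : LaurentPolynomial ℂ → FractionRing (LaurentPolynomial ℂ) :=
  algebraMap (LaurentPolynomial ℂ) (FractionRing (LaurentPolynomial ℂ))

/-- The variable `s` in the field of rational functions. -/
noncomputable def ratS : FractionRing (LaurentPolynomial ℂ) :=
  toRational (LaurentPolynomial.T 1)

end Conway

/-! Fix everything except the number `a` of twists of two parallel strands in one place, and let `g
a` be the resulting Alexander–Conway polynomial. Adding a negative crossing, a positive crossing or
none to `a` twists gives `a + 1`, `a - 1` and `a` twists, so the skein relation becomes the linear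
recurrence g(a+1) = g(a-1) + (s⁻¹ - s) g(a).

Its characteristic polynomial x² - (s⁻¹ - s)x - 1 has the roots s⁻¹ and -s, and C^a = s·(s⁻¹)^a +
s⁻¹·(-s)^a, so C^a is a solution. Since C^1 = 0 and C^0 = C^2 = (s² + 1)/s, the sequences C^a and
C^(a+1), multiplied by s/(s² + 1), are the solutions with values (1, 0) and (0, 1) at a = 0, 1. Two
consecutive values determine a solution, which yields the case of one exponent,
`SkeinRecurrence.expansion`.

Several exponents are expanded one at a time in `multi_expansion`, a statement about functions on
ℤ^p with no topology in it. The topology lies in the recurrence in each variable separately: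
`skeinRecurrence_braidMonomial` for closed braids, where adjacent powers of a generator combine in
the group, and `skeinRecurrence_fill` for boxes, where opposite crossings cancel by a second
Reidemeister move. -/

namespace Conway

open LaurentPolynomial

/-! ### The linear recurrence -/

/-- The recurrence that the skein relation imposes on the values at the powers of a crossing. -/
def SkeinRecurrence {K : Type*} [Field K] (s : K) (g : ℤ → K) : Prop :=
  ∀ a, g (a + 1) = g (a - 1) + (s⁻¹ - s) * g a

/-- The recurrence has order two and the coefficient of `g (a - 1)` is 1, so it can be solved in
both directions. The induction over ℤ therefore carries a pair of consecutive values. -/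
theorem SkeinRecurrence.ext {K : Type*} [Field K] {s : K} {g h : ℤ → K}
    (hg : SkeinRecurrence s g) (hh : SkeinRecurrence s h) (h₀ : g 0 = h 0) (h₁ : g 1 = h 1) :
    g = h := by
  have key : ∀ a : ℤ, g a = h a ∧ g (a + 1) = h (a + 1) := by
    intro a
    induction a using Int.induction_on with
    | zero => exact ⟨h₀, by simpa using h₁⟩
    | succ a ih =>
      refine ⟨ih.2, ?_⟩
      rw [hg, hh, ih.2, add_sub_cancel_right, ih.1]
    | pred a ih =>
      have e₁ := hg (-(a : ℤ))
      have e₂ := hh (-(a : ℤ))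
      rw [ih.1, ih.2, e₂] at e₁
      rw [sub_add_cancel]
      exact ⟨(add_right_cancel e₁).symm, ih.1⟩
  exact funext fun a => (key a).1

/-- The coefficient `C^a` as a function on a field. -/
def fieldCoeff {K : Type*} [Field K] (s : K) (a : ℤ) : K := (-1) ^ a * s ^ (a - 1) + s ^ (1 - a)

/-- The two summands are geometric sequences whose ratios, -s and s⁻¹, are the roots of the
characteristic polynomial. -/
theorem skeinRecurrence_fieldCoeff {K : Type*} [Field K] {s : K} (hs : s ≠ 0) :
    SkeinRecurrence s (fieldCoeff s) := by
  intro a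
  have h1 : (-1 : K) ≠ 0 := by simp
  simp only [fieldCoeff, zpow_add₀ h1, zpow_sub₀ h1, zpow_add₀ hs, zpow_sub₀ hs, zpow_one]
  field_simp
  ring

/-- The right side is a solution as a combination of shifts of `fieldCoeff s`. It agrees with `g` at
0 and 1, because the coefficient vanishes at 1 and equals (s² + 1)/s at 0 and 2. -/
theorem SkeinRecurrence.expansion {K : Type*} [Field K] {s : K} (hs : s ≠ 0)
    (hs' : s ^ 2 + 1 ≠ 0) {g : ℤ → K} (hg : SkeinRecurrence s g) (a : ℤ) :
    g a = s / (s ^ 2 + 1) * (fieldCoeff s a * g 0 + fieldCoeff s (a + 1) * g 1) := by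
  refine congrFun (hg.ext (h := fun a => s / (s ^ 2 + 1) *
    (fieldCoeff s a * g 0 + fieldCoeff s (a + 1) * g 1)) ?_ ?_ ?_) a
  · intro a
    have e₁ := skeinRecurrence_fieldCoeff hs a
    have e₂ := skeinRecurrence_fieldCoeff hs (a + 1)
    -- The goal contains the shifted coefficient at `a - 1` in the form `a - 1 + 1`.
    rw [show a + 1 - 1 = a - 1 + 1 by ring] at e₂
    simp only [e₁, e₂]
    ring
  · simp only [fieldCoeff]
    norm_num
    field_simp
    ring
  · simp only [fieldCoeff]
    norm_num
    field_simp

/-- Induction on the number of variables: with the first one frozen, the others are expanded by the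
induction hypothesis; then each of the resulting values is expanded in the first variable. -/
theorem multi_expansion {K : Type*} [Field K] {s : K} (hs : s ≠ 0) (hs' : s ^ 2 + 1 ≠ 0) {p : ℕ}
    (G : (Fin p → ℤ) → K)
    (hG : ∀ k m, SkeinRecurrence s fun z => G (Function.update k m z)) (k : Fin p → ℤ) :
    G k = (s / (s ^ 2 + 1)) ^ p * ∑ j : Fin p → Fin 2,
      (∏ m, fieldCoeff s (k m + ((j m : ℕ) : ℤ))) * G fun m => ((j m : ℕ) : ℤ) := by
  induction p with
  | zero => simp [Subsingleton.elim k Fin.elim0,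
      fun j : Fin 0 → Fin 2 => Subsingleton.elim (fun m => ((j m : ℕ) : ℤ)) Fin.elim0]
  | succ p ih =>
    have h₁ := ih (fun l => G (Fin.cons (k 0) l))
      (fun l m z => by simpa only [Fin.cons_update] using hG (Fin.cons (k 0) l) m.succ z)
      (Fin.tail k)
    rw [Fin.cons_self_tail] at h₁
    have h₂ (l : Fin p → ℤ) := SkeinRecurrence.expansion hs hs'
      (g := fun z => G (Fin.cons z l))
      (fun z => by simpa only [Fin.update_cons_zero] using hG (Fin.cons 0 l) 0 z) (k 0)
    have h₃ (c : Fin 2) (j : Fin p → Fin 2) :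
        (fun m => (((Fin.cons c j : Fin (p + 1) → Fin 2) m : ℕ) : ℤ))
          = (Fin.cons ((c : ℕ) : ℤ) fun m => ((j m : ℕ) : ℤ) : Fin (p + 1) → ℤ) := by
      funext m
      cases m using Fin.cases <;> simp
    -- The index set {0,1}^(p+1) is split into first coordinate and tail. The two values of the
    -- first coordinate are gathered under one sum over tails, so that the two sides can be compared
    -- tail by tail using `h₂`.
    rw [h₁, ← (Fin.consEquiv fun _ => Fin 2).sum_comp, Fintype.sum_prod_type, Fin.sum_univ_two,
      ← Finset.sum_add_distrib, pow_succ (s / _), mul_assoc]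
    congr 1
    rw [Finset.mul_sum]
    refine Finset.sum_congr rfl fun j _ => ?_
    simp only [Fin.consEquiv_apply, h₃, Fin.prod_univ_succ, Fin.cons_zero, Fin.cons_succ, h₂]
    simp [Fin.tail]
    ring

/-! ### The field of rational functions -/

theorem toRational_injective : Function.Injective toRational :=
  IsFractionRing.injective (LaurentPolynomial ℂ) (FractionRing (LaurentPolynomial ℂ))

theorem ratS_ne_zero : ratS ≠ 0 := by
  intro h
  have := toRational_injective (h.trans (map_zero (algebraMap _ _)).symm)
  exact (LaurentPolynomial.isUnit_T (R := ℂ) 1).ne_zero this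

theorem toRational_T (a : ℤ) : toRational (T a) = ratS ^ a := by
  have h (n : ℕ) : toRational (T n) = ratS ^ n := by
    rw [ratS, toRational, ← map_pow, T_pow]
    simp
  obtain ⟨n, rfl | rfl⟩ := a.eq_nat_or_neg
  · rw [h, zpow_natCast]
  · rw [zpow_neg, zpow_natCast, ← h]
    refine eq_inv_of_mul_eq_one_left ?_
    rw [toRational, ← map_mul, ← T_add]
    simp

theorem ratS_sq_add_one_ne_zero : ratS ^ 2 + 1 ≠ 0 := by
  intro h
  have e : toRational (T 2 + 1) = ratS ^ 2 + 1 := by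
    have h₂ : toRational (T 2) = ratS ^ 2 := by exact_mod_cast toRational_T 2
    rw [← h₂]
    simp only [toRational, map_add, map_one]
  have h₀ := toRational_injective ((e.trans h).trans (map_zero (algebraMap _ _)).symm)
  have h₁ : Polynomial.toLaurent (Polynomial.X ^ 2 + 1 : Polynomial ℂ) = 0 := by
    rw [← h₀]
    simp
  rw [Polynomial.toLaurent_eq_zero] at h₁
  -- X² + 1 takes the nonzero value 2 at 1.
  simpa using congrArg (Polynomial.eval 1) h₁

theorem toRational_expansionCoeff (a : ℤ) :
    toRational (expansionCoeff a) = fieldCoeff ratS a := by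
  have h : toRational (C ((-1) ^ a)) = (-1) ^ a := by
    -- Only the composite is a homomorphism between fields, which respects integer powers; the
    -- intermediate ring of Laurent polynomials is not a field.
    change ((algebraMap (LaurentPolynomial ℂ) _).comp C) ((-1) ^ a) = (-1) ^ a
    rw [map_zpow₀, map_neg, map_one]
  rw [fieldCoeff, ← h, ← toRational_T, ← toRational_T, expansionCoeff]
  simp only [toRational, map_add, map_mul]

/-- Here `f`, `g`, `h` play the roles of ∇(L₋), ∇(L₀), ∇(L₊); solved for ∇(L₋), the skein relation
has the shape of `SkeinRecurrence`. -/
theorem toRational_skein {f g h : LaurentPolynomial ℂ} (e : f - (T (-1) - T 1) * g - h = 0) :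
    toRational f = toRational h + (ratS⁻¹ - ratS) * toRational g := by
  have e' : f = h + (T (-1) - T 1) * g := by linear_combination e
  have h₁ : toRational (T (-1)) = ratS⁻¹ := by simpa using toRational_T (-1)
  rw [e', ← h₁, ratS]
  simp only [toRational, map_add, map_mul, map_sub]

/-! ### Closed braids -/

/-- A generator is a negative crossing when the strands run downwards, so it stands for L₋ and its
inverse for L₊. Words for α and β may be chosen freely by `conwayOfBraid_toBraid`. -/
theorem conway_braid_skein {n : ℕ} (i : Fin (n - 1)) (α β : BraidGroup n) :
    conwayOfBraid (α * braidGen i * β) - (T (-1) - T 1) * conwayOfBraid (α * β)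
      - conwayOfBraid (α * (braidGen i)⁻¹ * β) = 0 := by
  obtain ⟨u, rfl⟩ := BraidWord.toBraid_surjective α
  obtain ⟨v, rfl⟩ := BraidWord.toBraid_surjective β
  have e₁ : u.toBraid * braidGen i * v.toBraid = BraidWord.toBraid (u ++ [(i, true)] ++ v) := by
    simp only [BraidWord.toBraid, ← FreeGroup.mul_mk, map_mul]; rfl
  have e₂ : u.toBraid * (braidGen i)⁻¹ * v.toBraid
      = BraidWord.toBraid (u ++ [(i, false)] ++ v) := by
    simp only [BraidWord.toBraid, ← FreeGroup.mul_mk, map_mul]; rfl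
  have e₃ : u.toBraid * v.toBraid = BraidWord.toBraid (u ++ v) := by
    simp only [BraidWord.toBraid, ← FreeGroup.mul_mk, map_mul]
  rw [e₁, e₂, e₃, conwayOfBraid_toBraid, conwayOfBraid_toBraid, conwayOfBraid_toBraid]
  -- At the level of the crossing there are `i` downward strands, the two that cross, `d` further
  -- downward strands, and the `n` upward strands of the closure.
  obtain ⟨d, hd⟩ : ∃ d, n = i + (d + 2) := ⟨n - i - 2, by omega⟩
  refine alexanderConway_spec.skein _ _ _ ⟨openStrands n ++ u.slices,
    v.slices ++ closeStrands n, List.replicate i true,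
    List.replicate d true ++ List.replicate n false, true, ?_, ?_, ?_, ?_⟩
  · rw [run_append, run_openStrands, Option.bind_some, run_slices]
    conv_lhs => rw [hd, ← List.replicate_append_replicate]
    simp [List.replicate_succ, ← hd]
  all_goals simp [BraidWord.closure, BraidWord.slices]

/-- α and β are the products of the factors before and after position `m`; the point is that they do
not depend on `z`. -/
theorem prod_ofFn_update {M : Type*} [Monoid M] {k : ℕ} (f : Fin k → M) (m : Fin k) :
    ∃ α β : M, ∀ z, (List.ofFn (Function.update f m z)).prod = α * z * β := by
  induction k with
  | zero => exact m.elim0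
  | succ k ih =>
    cases m using Fin.cases with
    | zero =>
      refine ⟨1, (List.ofFn fun j => f j.succ).prod, fun z => ?_⟩
      simp [List.ofFn_succ]
    | succ m =>
      obtain ⟨α, β, h⟩ := ih (fun j => f j.succ) m
      refine ⟨f 0 * α, β, fun z => ?_⟩
      have e : (fun j : Fin k => Function.update f m.succ z j.succ)
          = Function.update (fun j => f j.succ) m z := by
        funext j; simp [Function.update_apply]
      rw [List.ofFn_succ, e, List.prod_cons, h, Function.update_of_ne (Fin.succ_ne_zero m).symm]
      simp only [mul_assoc]

theorem skeinRecurrence_braidMonomial {n k : ℕ} (i : Fin k → Fin (n - 1)) (a : Fin k → ℤ)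
    (m : Fin k) : SkeinRecurrence ratS fun z =>
      toRational (conwayOfBraid (braidMonomial i (Function.update a m z))) := by
  obtain ⟨α, β, h⟩ := prod_ofFn_update (fun m => braidGen (i m) ^ a m) m
  have e (z : ℤ) : braidMonomial i (Function.update a m z) = α * braidGen (i m) ^ z * β := by
    rw [← h, braidMonomial]
    congr 2
    funext j
    rcases eq_or_ne j m with rfl | hj
    · simp
    · simp [hj]
  intro z
  -- With the power `z` absorbed into the left factor, L₋, L₀, L₊ have the exponents `z + 1`, `z`,
  -- `z - 1`.
  have := conway_braid_skein (i m) (α * braidGen (i m) ^ z) β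
  simp only [e]
  rw [zpow_add_one, zpow_sub_one, ← mul_assoc, ← mul_assoc]
  exact toRational_skein this

/-! ### Twist families -/

/-- This exhibits the two parallel strands of a box in the form that `SkeinTriple` asks for. -/
theorem exists_of_boxAct {i : ℕ} {l l' : List Bool} (h : boxAct i l = some l') :
    ∃ (l₁ l₂ : List Bool) (o : Bool), l₁.length = i ∧ l = l₁ ++ o :: o :: l₂ := by
  induction i generalizing l l' with
  | zero =>
    rcases l with _ | ⟨a, _ | ⟨a', l⟩⟩ <;> simp [boxAct] at h
    exact ⟨[], l, a, rfl, by simp [h.1]⟩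
  | succ i ih =>
    cases l with
    | nil => simp [boxAct] at h
    | cons a l =>
      simp only [boxAct, Option.map_eq_some_iff] at h
      obtain ⟨l₃, h, -⟩ := h
      obtain ⟨l₁, l₂, o, rfl, rfl⟩ := ih h
      exact ⟨a :: l₁, l₂, o, rfl, rfl⟩

/-- A crossing followed by its inverse can be removed. -/
theorem alexanderConway_cancel {D D' : LinkDiagram} {u v : List Slice} {i : ℕ} (b : Bool)
    (h : D.word = u ++ (i, .cross b) :: (i, .cross !b) :: v) (h' : D'.word = u ++ v) :
    alexanderConway D = alexanderConway D' :=
  alexanderConway_spec.isotopy _ _ (.rel _ _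
    ⟨u, _, _, v, (Move.reidemeister_two b).shift i, by simp [h], by simp [h']⟩)

/-- The sign condition is needed because `twist` is a reduced word: for negative `a`, passing to `a
+ 1` removes a crossing instead of adding one. -/
theorem twist_succ (i : ℕ) {a : ℤ} (ha : 0 ≤ a) :
    twist i (a + 1) = (i, .cross true) :: twist i a := by
  obtain ⟨n, rfl⟩ := Int.eq_ofNat_of_zero_le ha
  have : 0 ≤ (n : ℤ) + 1 := by omega
  simp only [twist, this, ha, decide_true]
  rw [show ((n : ℤ) + 1).natAbs = (n : ℤ).natAbs + 1 by omega, List.replicate_succ]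

theorem twist_pred (i : ℕ) {a : ℤ} (ha : a ≤ 0) :
    twist i (a - 1) = (i, .cross false) :: twist i a := by
  have h₁ : ¬ 0 ≤ a - 1 := by omega
  rcases ha.lt_or_eq with h | rfl
  · have h₂ : ¬ 0 ≤ a := by omega
    simp only [twist, h₁, h₂, decide_false]
    rw [show (a - 1).natAbs = a.natAbs + 1 by omega, List.replicate_succ]
  -- At `a = 0` the twist is empty, so the crossing type chosen by `decide` is irrelevant.
  · simp [twist]

/-- The skein relation is applied to an extra crossing placed on top of `z` twists. That crossing
changes `z` by one, either literally or after cancelling against the topmost crossing of the twist.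
-/
theorem skeinRecurrence_twist {u v : List Slice} {l l' : List Bool} {o : Bool}
    (hu : run u [] = some (l ++ o :: o :: l')) (D : ℤ → LinkDiagram)
    (hD : ∀ z, (D z).word = u ++ (twist l.length z ++ v)) :
    SkeinRecurrence ratS fun z => toRational (alexanderConway (D z)) := by
  intro z
  -- A crossing of parallel strands leaves the list of orientations unchanged, so the word with the
  -- extra crossing is still a closed diagram.
  have closed (b : Bool) :
      run (u ++ (l.length, .cross b) :: (twist l.length z ++ v)) [] = some [] := by
    have h := (D z).closed
    rw [hD, run_append, hu, Option.bind_some] at h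
    rw [run_append, hu, Option.bind_some, run, actAt_cross_parallel, Option.bind_some, h]
  have key := alexanderConway_spec.skein ⟨_, closed false⟩ (D z) ⟨_, closed true⟩
    ⟨u, _, l, l', o, hu, rfl, hD z, rfl⟩
  have pos : alexanderConway ⟨_, closed true⟩ = alexanderConway (D (z + 1)) := by
    -- For `z ≥ 0` the two words coincide. For `z < 0` the twist starts with the opposite crossing,
    -- and a second Reidemeister move removes the pair.
    rcases le_or_gt 0 z with hz | hz
    · exact congrArg _ (LinkDiagram.mk.injEq .. |>.mpr (by rw [hD, twist_succ _ hz]; rfl))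
    · have e := twist_pred l.length (show z + 1 ≤ 0 by omega)
      rw [add_sub_cancel_right] at e
      exact alexanderConway_cancel (i := l.length) true (by simp [e]) (hD _)
  have neg : alexanderConway ⟨_, closed false⟩ = alexanderConway (D (z - 1)) := by
    rcases le_or_gt z 0 with hz | hz
    · exact congrArg _ (LinkDiagram.mk.injEq .. |>.mpr (by rw [hD, twist_pred _ hz]; rfl))
    · have e := twist_succ l.length (show 0 ≤ z - 1 by omega)
      rw [sub_add_cancel] at e
      exact alexanderConway_cancel (i := l.length) false (by simp [e]) (hD _)
  rw [pos, neg] at key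
  exact toRational_skein key

theorem fillBoxes_append {p : ℕ} (k : Fin p → ℤ) (w w' : List (Slice ⊕ ℕ × Fin p)) :
    fillBoxes k (w ++ w') = fillBoxes k w ++ fillBoxes k w' := by
  induction w with
  | nil => rfl
  | cons x w ih =>
    rcases x with x | ⟨i, j⟩ <;> simp [fillBoxes, ih]

theorem runBoxes_append {p : ℕ} (w w' : List (Slice ⊕ ℕ × Fin p)) (l : List Bool) :
    runBoxes (w ++ w') l = (runBoxes w l).bind (runBoxes w') := by
  induction w generalizing l with
  | nil => rfl
  | cons x w ih =>
    rcases x with ⟨i, e⟩ | ⟨i, j⟩ <;>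
      simp only [List.cons_append, runBoxes, Option.bind_assoc, ih]

/-- The indices of the boxes of a word. -/
abbrev boxIndices {p : ℕ} (w : List (Slice ⊕ ℕ × Fin p)) : List (Fin p) :=
  w.filterMap (Sum.elim (fun _ => none) fun x => some x.2)

theorem fillBoxes_update {p : ℕ} (k : Fin p → ℤ) (j : Fin p) (z : ℤ)
    {w : List (Slice ⊕ ℕ × Fin p)} (h : j ∉ boxIndices w) :
    fillBoxes (Function.update k j z) w = fillBoxes k w := by
  induction w with
  | nil => rfl
  | cons x w ih =>
    rcases x with x | ⟨i, j'⟩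
    · simp only [fillBoxes]
      rw [ih (by simpa using h)]
    · simp only [boxIndices, List.filterMap_cons, Sum.elim_inr, List.mem_cons, not_or] at h
      simp only [fillBoxes]
      rw [ih h.2, Function.update_of_ne (Ne.symm h.1)]

/-- One occurrence uses up the whole count, so none is left on either side; hence varying the `j`-th
exponent changes the diagram in a single place. -/
theorem exists_split_box {p : ℕ} (j : Fin p) (w : List (Slice ⊕ ℕ × Fin p))
    (h : (boxIndices w).count j = 1) :
    ∃ (w₁ w₂ : List (Slice ⊕ ℕ × Fin p)) (i : ℕ), w = w₁ ++ .inr (i, j) :: w₂ ∧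
      j ∉ boxIndices w₁ ∧ j ∉ boxIndices w₂ := by
  have hj : j ∈ boxIndices w := List.count_pos_iff.mp (by omega)
  obtain ⟨x, hx, e⟩ := List.mem_filterMap.mp hj
  rcases x with x | ⟨i, j'⟩
  · simp at e
  obtain rfl : j' = j := by simpa using e
  obtain ⟨w₁, w₂, rfl⟩ := List.append_of_mem hx
  rw [boxIndices, List.filterMap_append, List.filterMap_cons_some (by rfl), List.count_append,
    List.count_cons_self] at h
  change (boxIndices w₁).count j' + ((boxIndices w₂).count j' + 1) = 1 at h
  exact ⟨w₁, w₂, i, rfl, List.count_eq_zero.mp (by omega), List.count_eq_zero.mp (by omega)⟩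

/-- Filling the boxes above box `j` does not change the orientations that arrive at it
(`run_fillBoxes`), so its two strands are parallel in every filled diagram and
`skeinRecurrence_twist` applies. -/
theorem skeinRecurrence_fill {p : ℕ} (L : TwistFamily p) (k : Fin p → ℤ) (j : Fin p) :
    SkeinRecurrence ratS fun z =>
      toRational (alexanderConway (L.fill (Function.update k j z))) := by
  obtain ⟨w₁, w₂, i, hw, h₁, h₂⟩ := exists_split_box j L.word (L.once j)
  have c := L.closed
  rw [hw, runBoxes_append, Option.bind_eq_some_iff] at c
  obtain ⟨l, hl, c⟩ := c
  simp only [runBoxes, Option.bind_eq_some_iff] at c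
  obtain ⟨l', hl', -⟩ := c
  obtain ⟨l₁, l₂, o, rfl, rfl⟩ := exists_of_boxAct hl'
  refine skeinRecurrence_twist (v := fillBoxes k w₂) (run_fillBoxes k w₁ _ _ hl) _ fun z => ?_
  simp only [TwistFamily.fill, hw, fillBoxes_append, fillBoxes]
  rw [fillBoxes_update k j z h₁, fillBoxes_update k j z h₂, Function.update_self]

end Conway

/-- The exponents j ∈ {0,1}^k are encoded as functions to `Fin 2`. For `n ≤ 1` the type `Fin (n -
1)` is empty, which forces `k = 0` and makes the first formula trivial. -/
theorem theorem1p4 :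
    (∀ (n k : ℕ) (i : Fin k → Fin (n - 1)) (a : Fin k → ℤ),
      Conway.toRational (Conway.conwayOfBraid (Conway.braidMonomial i a)) =
        (Conway.ratS / (Conway.ratS ^ 2 + 1)) ^ k *
          ∑ j : Fin k → Fin 2,
            (∏ m, Conway.toRational (Conway.expansionCoeff (a m + ((j m : ℕ) : ℤ)))) *
              Conway.toRational
                (Conway.conwayOfBraid (Conway.braidMonomial i fun m => ((j m : ℕ) : ℤ)))) ∧
    (∀ (p : ℕ) (L : Conway.TwistFamily p) (k : Fin p → ℤ),
      Conway.toRational (Conway.alexanderConway (L.fill k)) =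
        (Conway.ratS / (Conway.ratS ^ 2 + 1)) ^ p *
          ∑ j : Fin p → Fin 2,
            (∏ m, Conway.toRational (Conway.expansionCoeff (k m + ((j m : ℕ) : ℤ)))) *
              Conway.toRational
                (Conway.alexanderConway (L.fill fun m => ((j m : ℕ) : ℤ)))) := by
  refine ⟨fun n k i a => ?_, fun p L k => ?_⟩
  · simp only [Conway.toRational_expansionCoeff]
    exact Conway.multi_expansion Conway.ratS_ne_zero Conway.ratS_sq_add_one_ne_zero
      (fun a => Conway.toRational (Conway.conwayOfBraid (Conway.braidMonomial i a)))
      (Conway.skeinRecurrence_braidMonomial i) a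
  · simp only [Conway.toRational_expansionCoeff]
    exact Conway.multi_expansion Conway.ratS_ne_zero Conway.ratS_sq_add_one_ne_zero
      (fun k => Conway.toRational (Conway.alexanderConway (L.fill k)))
      (Conway.skeinRecurrence_fill L) k
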